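/- Let $\mathcal G$ and $\mathcal H$ be proper étale groupoids, i.e. smooth (Lie) groupoids, with Hausdorff finite-dimensional manifolds of objects $\mathcal G_0,\mathcal H_0$ and arrows $\mathcal G_1,\mathcal H_1$, whose source and target maps $s,t$ are local diffeomorphisms and whose diagonal $(s,t)$ is a proper map. Let $$\mathcal G_0\xleftarrow{\ \tau\ } M\xrightarrow{\ \varepsilon\ }\mathcal H_0$$ be a Hilsum–Skandalis Morita equivalence: $M$ is a Hausdorff manifold with a smooth right $\mathcal G$-action ($mg$ defined for $\tau(m)=t(g)$, with $\tau(mg)=s(g)$ and $\varepsilon(mg)=\varepsilon(m)$) and a smooth left $\mathcal H$-action ($hm$ defined for $s(h)=\varepsilon(m)$, with $\varepsilon(hm)=t(h)$ and $\tau(hm)=\tau(m)$) that commute, $\tau$ and $\varepsilon$ are surjective submersions, and the maps $M\times_{\mathcal G_0}\mathcal G_1\to M\times_{\mathcal H_0}M$, $(m,g)\mapsto(m,mg)$, and $\mathcal H_1\times_{\mathcal H_0}M\to M\times_{\mathcal G_0}M$, $(h,m)\mapsto(hm,m)$, are diffeomorphisms. A connected, simply connected open set $\widetilde U\subseteq\mathcal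 G_0$ is a *translation open set* if the group $G_U$ of local bisections $\sigma\colon\widetilde U\to\mathcal G_1$ (smooth, $s\circ\sigma=\mathrm{id}$, $t\circ\sigma$ a diffeomorphism onto its image) with $t(\sigma(\widetilde U))=\widetilde U$ is finite and the evaluation $(\sigma,u)\mapsto\sigma(u)$ is an isomorphism of Lie groupoids $G_U\ltimes\widetilde U\to\mathcal G|_{\widetilde U}$; the group $G_U$ acts on $\widetilde U$ by $\sigma\cdot u=t(\sigma(u))$. Translation open sets $\widetilde W\subseteq\mathcal H_0$ and their groups $H_W$ are defined likewise for $\mathcal H$. Let $\mathcal V$ and $\mathcal W$ be families of translation open subsets of $\mathcal G_0$ and of $\mathcal H_0$ (for instance the charts of the orbifold atlases built from $\mathcal G$ and $\mathcal H$). An *invariant local bisection* of $M$ is a nonempty open set $S\subseteq M$ such that $\tau$ and $\varepsilon$ restrict to diffeomorphisms from $S$ onto open sets $\tau(S)\subseteq\widetilde V$ and $\varepsilon(S)\subseteq\widetilde W$, for some $\widetilde V\in\mathcal V$ and $\widetilde W\in\mathcal W$, which are invariant: for each $g\in G_V$ either $g(\tau(S))=\tau(S)$ or $g(\tau(S))\cap\tau(S)=\varnothing$,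 and for each $h\in H_W$ either $h(\varepsilon(S))=\varepsilon(S)$ or $h(\varepsilon(S))\cap\varepsilon(S)=\varnothing$. Then the invariant local bisections of $M$ are contained in, and form a basis for the topology of, the subspace $$\tau^{-1}\Bigl(\bigcup_{\widetilde V\in\mathcal V}\widetilde V\Bigr)\cap\varepsilon^{-1}\Bigl(\bigcup_{\widetilde W\in\mathcal W}\widetilde W\Bigr)\subseteq M .$$ -/

import Mathlib

open Set TopologicalSpace
open scoped Manifold ContDiff

/-- `f` restricts to a diffeomorphism from `A` onto `B`.
Here `A` and `B` are open subsets or embedded submanifolds (fibre products over submersions) of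
the ambient manifolds; on such subsets `ContMDiffOn` is smoothness for the submanifold structure.
The values of `f` outside `A` and those of the inverse outside `B` are irrelevant. -/
def IsDiffeoOn {E E' : Type*} [NormedAddCommGroup E] [NormedSpace ℝ E]
    [NormedAddCommGroup E'] [NormedSpace ℝ E']
    {X X' : Type*} [TopologicalSpace X] [TopologicalSpace X']
    (I : ModelWithCorners ℝ E X) (J : ModelWithCorners ℝ E' X')
    {P Q : Type*} [TopologicalSpace P] [ChartedSpace X P] [TopologicalSpace Q] [ChartedSpace X' Q]
    (f : P → Q) (A : Set P) (B : Set Q) : Prop :=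
  ContMDiffOn I J ∞ f A ∧ f '' A = B ∧ ∃ g : Q → P, ContMDiffOn J I ∞ g B ∧ LeftInvOn g f A

/-- A smooth étale groupoid with proper diagonal, with space of objects `G₀` and space of arrows
`G₁` (smooth `n`-manifolds). The composite `comp g g'` (first `g'`, then `g`) is only meaningful
when `s g = t g'`; its values on other pairs are irrelevant. -/
structure ProperEtaleGroupoid (n : ℕ) (G₀ G₁ : Type*)
    [TopologicalSpace G₀] [ChartedSpace (EuclideanSpace ℝ (Fin n)) G₀]
    [TopologicalSpace G₁] [ChartedSpace (EuclideanSpace ℝ (Fin n)) G₁] where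
  /-- source -/
  s : G₁ → G₀
  /-- target -/
  t : G₁ → G₀
  /-- unit -/
  unit : G₀ → G₁
  /-- inverse -/
  inv : G₁ → G₁
  /-- composition -/
  comp : G₁ → G₁ → G₁
  s_unit : ∀ x, s (unit x) = x
  t_unit : ∀ x, t (unit x) = x
  s_inv : ∀ g, s (inv g) = t g
  t_inv : ∀ g, t (inv g) = s g
  s_comp : ∀ g g', s g = t g' → s (comp g g') = s g'
  t_comp : ∀ g g', s g = t g' → t (comp g g') = t g
  comp_assoc : ∀ g g' g'', s g = t g' → s g' = t g'' →
    comp (comp g g') g'' = comp g (comp g' g'')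
  unit_comp : ∀ g, comp (unit (t g)) g = g
  comp_unit : ∀ g, comp g (unit (s g)) = g
  inv_comp : ∀ g, comp (inv g) g = unit (s g)
  comp_inv : ∀ g, comp g (inv g) = unit (t g)
  smooth_unit : ContMDiff (𝓡 n) (𝓡 n) ∞ unit
  smooth_inv : ContMDiff (𝓡 n) (𝓡 n) ∞ inv
  smooth_comp : ContMDiffOn ((𝓡 n).prod (𝓡 n)) (𝓡 n) ∞ (fun p : G₁ × G₁ => comp p.1 p.2)
    {p | s p.1 = t p.2}
  /-- étale: source and target are local diffeomorphisms -/
  etale_s : IsLocalDiffeomorph (𝓡 n) (𝓡 n) ∞ s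
  etale_t : IsLocalDiffeomorph (𝓡 n) (𝓡 n) ∞ t
  /-- the diagonal is proper -/
  proper : IsProperMap (fun g => (s g, t g))

namespace ProperEtaleGroupoid

variable {n : ℕ} {G₀ G₁ : Type*}
  [TopologicalSpace G₀] [ChartedSpace (EuclideanSpace ℝ (Fin n)) G₀]
  [TopologicalSpace G₁] [ChartedSpace (EuclideanSpace ℝ (Fin n)) G₁]
  (G : ProperEtaleGroupoid n G₀ G₁)

/-- `σ` is (the section of) a local bisection defined on the open set `U`: a smooth section of the
source map over `U` such that the target map is injective on its image. As `s` and `t` are local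
diffeomorphisms, the image `σ(U)` is then open and `s`, `t` map it diffeomorphically onto open
subsets of the space of objects. -/
structure IsLocalBisection (U : Opens G₀) (σ : U → G₁) : Prop where
  smooth : ContMDiff (𝓡 n) (𝓡 n) ∞ σ
  section_s : ∀ u, G.s (σ u) = u
  injective_t : Function.Injective (fun u => G.t (σ u))

/-- The (underlying set of the) group `G_U` of local bisections defined on `U` that carry `U` onto
itself. -/
def SelfBisection (U : Opens G₀) : Type _ :=
  {σ : U → G₁ // G.IsLocalBisection U σ ∧ range (fun u => G.t (σ u)) = (U : Set G₀)}

/-- The evaluation map `(σ, u) ↦ σ(u)` from the arrows of the translation groupoid `G_U ⋉ U` to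
the arrows of the restriction of `G` to `U`. -/
def evalMap (U : Opens G₀) (p : G.SelfBisection U × U) :
    {g : G₁ // G.s g ∈ U ∧ G.t g ∈ U} :=
  ⟨p.1.1 p.2, by
    rw [p.1.2.1.section_s]; exact p.2.2, by
    have h : G.t (p.1.1 p.2) ∈ range (fun u => G.t (p.1.1 u)) := ⟨p.2, rfl⟩
    rw [p.1.2.2] at h; exact h⟩

/-- Translation open subsets of the space of objects. The evaluation map is always a functor over
the identity of `U`, because the product of `G_U` is `(σ'σ)(u) = σ'(t(σ(u))) σ(u)`. As `G_U` is
discrete, `G_U × U` is a disjoint union of copies of `U`, and evaluation is a diffeomorphism (an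
isomorphism of Lie groupoids) iff it is bijective and a local diffeomorphism on each copy. -/
structure IsTranslationOpen (U : Opens G₀) : Prop where
  connected : IsConnected (U : Set G₀)
  simplyConnected : SimplyConnectedSpace U
  finite : Finite (G.SelfBisection U)
  eval_bijective : Function.Bijective (G.evalMap U)
  eval_localDiffeo : ∀ σ : G.SelfBisection U, IsLocalDiffeomorph (𝓡 n) (𝓡 n) ∞ σ.1

/-- The image `g(A ∩ V)` of a set under the action `u ↦ t(g(u))` of an element `g` of `G_V`
on `V`. -/
def bisectionImage {V : Opens G₀} (g : G.SelfBisection V) (A : Set G₀) : Set G₀ :=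
  {y | ∃ u : V, (u : G₀) ∈ A ∧ G.t (g.1 u) = y}

/-- `A` is an invariant subset of `V`: every `g ∈ G_V` either maps `A` onto itself or moves it off
itself. -/
def IsInvariantSubset (V : Opens G₀) (A : Set G₀) : Prop :=
  A ⊆ V ∧ ∀ g : G.SelfBisection V, G.bisectionImage g A = A ∨ G.bisectionImage g A ∩ A = ∅

end ProperEtaleGroupoid

/-- A Hilsum–Skandalis Morita equivalence `M : G ⇸ H` with bundle maps
`τ : M → G₀` and `ε : M → H₀`: a right `G`-action and a left `H`-action that commute, such that `M`
is a principal right `G`-bundle over `H₀` via `ε` and a principal left `H`-bundle over `G₀` via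
`τ`. The values `m g` with `τ m ≠ t g` and `h m` with `s h ≠ ε m` are irrelevant. -/
structure MoritaBibundle {n p : ℕ} (k : ℕ) {G₀ G₁ H₀ H₁ : Type*}
    [TopologicalSpace G₀] [ChartedSpace (EuclideanSpace ℝ (Fin n)) G₀]
    [TopologicalSpace G₁] [ChartedSpace (EuclideanSpace ℝ (Fin n)) G₁]
    [TopologicalSpace H₀] [ChartedSpace (EuclideanSpace ℝ (Fin p)) H₀]
    [TopologicalSpace H₁] [ChartedSpace (EuclideanSpace ℝ (Fin p)) H₁]
    (G : ProperEtaleGroupoid n G₀ G₁) (H : ProperEtaleGroupoid p H₀ H₁)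
    (M : Type*) [TopologicalSpace M] [ChartedSpace (EuclideanSpace ℝ (Fin k)) M] where
  τ : M → G₀
  ε : M → H₀
  /-- right action of `G`, written `m g` -/
  rAct : M → G₁ → M
  /-- left action of `H`, written `h m` -/
  lAct : H₁ → M → M
  ε_rAct : ∀ m g, τ m = G.t g → ε (rAct m g) = ε m
  τ_rAct : ∀ m g, τ m = G.t g → τ (rAct m g) = G.s g
  rAct_unit : ∀ m, rAct m (G.unit (τ m)) = m
  rAct_comp : ∀ m g g', τ m = G.t g → G.s g = G.t g' →
    rAct (rAct m g) g' = rAct m (G.comp g g')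
  τ_lAct : ∀ h m, H.s h = ε m → τ (lAct h m) = τ m
  ε_lAct : ∀ h m, H.s h = ε m → ε (lAct h m) = H.t h
  unit_lAct : ∀ m, lAct (H.unit (ε m)) m = m
  comp_lAct : ∀ h h' m, H.s h = H.t h' → H.s h' = ε m →
    lAct h (lAct h' m) = lAct (H.comp h h') m
  act_comm : ∀ h m g, H.s h = ε m → τ m = G.t g → lAct h (rAct m g) = rAct (lAct h m) g
  smooth_rAct : ContMDiffOn ((𝓡 k).prod (𝓡 n)) (𝓡 k) ∞ (fun q : M × G₁ => rAct q.1 q.2)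
    {q | τ q.1 = G.t q.2}
  smooth_lAct : ContMDiffOn ((𝓡 p).prod (𝓡 k)) (𝓡 k) ∞ (fun q : H₁ × M => lAct q.1 q.2)
    {q | H.s q.1 = ε q.2}
  ε_surjective : Function.Surjective ε
  ε_submersion : Manifold.IsSubmersion (𝓡 k) (𝓡 p) ∞ ε
  /-- `(m, g) ↦ (m, m g)` is a diffeomorphism `M ×_{G₀} G₁ → M ×_{H₀} M` -/
  right_principal : IsDiffeoOn ((𝓡 k).prod (𝓡 n)) ((𝓡 k).prod (𝓡 k))
    (fun q : M × G₁ => (q.1, rAct q.1 q.2)) {q | τ q.1 = G.t q.2} {q | ε q.1 = ε q.2}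
  τ_surjective : Function.Surjective τ
  τ_submersion : Manifold.IsSubmersion (𝓡 k) (𝓡 n) ∞ τ
  /-- `(h, m) ↦ (h m, m)` is a diffeomorphism `H₁ ×_{H₀} M → M ×_{G₀} M` -/
  left_principal : IsDiffeoOn ((𝓡 p).prod (𝓡 k)) ((𝓡 k).prod (𝓡 k))
    (fun q : H₁ × M => (lAct q.1 q.2, q.2)) {q | H.s q.1 = ε q.2} {q | τ q.1 = τ q.2}

namespace MoritaBibundle

variable {n p k : ℕ} {G₀ G₁ H₀ H₁ : Type*}
  [TopologicalSpace G₀] [ChartedSpace (EuclideanSpace ℝ (Fin n)) G₀]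
  [TopologicalSpace G₁] [ChartedSpace (EuclideanSpace ℝ (Fin n)) G₁]
  [TopologicalSpace H₀] [ChartedSpace (EuclideanSpace ℝ (Fin p)) H₀]
  [TopologicalSpace H₁] [ChartedSpace (EuclideanSpace ℝ (Fin p)) H₁]
  {G : ProperEtaleGroupoid n G₀ G₁} {H : ProperEtaleGroupoid p H₀ H₁}
  {M : Type*} [TopologicalSpace M] [ChartedSpace (EuclideanSpace ℝ (Fin k)) M]
  (B : MoritaBibundle k G H M)

/-- Invariant local bisections of `M`, relative to families `𝒱` and `𝒲` of translation open subsets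
of `G₀` and `H₀`: (nonempty) open sets `S` that `τ` and `ε` map diffeomorphically onto open
invariant subsets of some `V ∈ 𝒱` and some `W ∈ 𝒲` respectively. -/
structure IsInvariantLocalBisection (𝒱 : Set (Opens G₀)) (𝒲 : Set (Opens H₀)) (S : Set M) :
    Prop where
  nonempty : S.Nonempty
  isOpen : IsOpen S
  isOpen_τ : IsOpen (B.τ '' S)
  isOpen_ε : IsOpen (B.ε '' S)
  diffeo_τ : IsDiffeoOn (𝓡 k) (𝓡 n) B.τ S (B.τ '' S)
  diffeo_ε : IsDiffeoOn (𝓡 k) (𝓡 p) B.ε S (B.ε '' S)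
  invariant_τ : ∃ V ∈ 𝒱, G.IsInvariantSubset V (B.τ '' S)
  invariant_ε : ∃ W ∈ 𝒲, H.IsInvariantSubset W (B.ε '' S)

/-- The subset of `M` lying over the union of `𝒱` and the union of `𝒲`. -/
def chartRegion (𝒱 : Set (Opens G₀)) (𝒲 : Set (Opens H₀)) : Set M :=
  B.τ ⁻¹' (⋃ V ∈ 𝒱, (V : Set G₀)) ∩ B.ε ⁻¹' (⋃ W ∈ 𝒲, (W : Set H₀))

end MoritaBibundle

/-! Both bundle maps are local diffeomorphisms. Two points of one `τ`-fibre differ by a unique arrow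
of `H`, which depends continuously on the pair and is a unit on the diagonal. Since `H` is étale it
is a unit near the diagonal, so `τ` is locally injective, and a locally injective submersion is a
local diffeomorphism; `ε` is symmetric.

It remains to shrink a neighbourhood of `m` until both images are invariant at once. In a
translation open set, `exists_isOpen_invariant` gives small open sets around a point that its
stabiliser preserves and all other bisections move off themselves. Let `O` be a neighbourhood of `m`
on which `τ` is injective, and `S` the part of `O` over such a set `A` around `τ m`; then `τ(S) = A`
is invariant. If `h` fixes `ε m`, then `h m = m g` for an arrow `g` from `τ m` to itself, and `g`
extends to a bisection `σ` of `V`. The map `q ↦ h q σ⁻¹` fixes `m`, lies over `σ` via `τ` and over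
`h` via `ε`. As `σ(A) = A` and `τ` is injective on `O`, it carries `S` onto itself, so `h(ε(S)) =
ε(S)`. The remaining `h` move `ε(S)` off itself once `S` is small. -/

open scoped Topology

/-! ### Stable neighbourhoods and local injectivity -/

/-- A finite family of continuous maps fixing `x` whose germs at `x` form a group admits arbitrarily
small open neighbourhoods of `x` that every map of the family carries onto themselves. -/
lemma exists_isOpen_image_eq_of_finite {X ι : Type*} [TopologicalSpace X] [Finite ι]
    (Θ : ι → X → X) (hc : ∀ i, Continuous (Θ i)) {x : X} (hx : ∀ i, Θ i x = x)
    (hmul : ∀ i j, ∃ l, ∀ᶠ u in 𝓝 x, Θ i (Θ j u) = Θ l u)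
    (hinv : ∀ i, ∃ j, ∀ᶠ u in 𝓝 x, Θ i (Θ j u) = u) {N : Set X} (hN : N ∈ 𝓝 x) :
    ∃ S, IsOpen S ∧ x ∈ S ∧ S ⊆ N ∧ ∀ i, Θ i '' S = S := by
  choose l hl using hmul
  choose r hr using hinv
  have hev : ∀ᶠ u in 𝓝 x, u ∈ N ∧ (∀ i j, Θ i (Θ j u) = Θ (l i j) u) ∧
      ∀ i, Θ i (Θ (r i) u) = u :=
    (Filter.eventually_mem_set.2 hN).and
      ((Filter.eventually_all.2 fun i => Filter.eventually_all.2 (hl i)).and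
        (Filter.eventually_all.2 hr))
  obtain ⟨D, hD, hDo, hxD⟩ := eventually_nhds_iff.1 hev
  -- On `D` the composite `Θ j ∘ Θ i` is again a member of the family, so the points that the whole
  -- family keeps in `D` are stable.
  have hmaps : ∀ i, MapsTo (Θ i) (D ∩ ⋂ j, Θ j ⁻¹' D) (D ∩ ⋂ j, Θ j ⁻¹' D) := by
    rintro i u ⟨hu, hu'⟩
    rw [mem_iInter] at hu'
    refine ⟨hu' i, mem_iInter.2 fun j => ?_⟩
    rw [mem_preimage, (hD u hu).2.1 j i]
    exact hu' _
  refine ⟨D ∩ ⋂ j, Θ j ⁻¹' D,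
    hDo.inter (isOpen_iInter_of_finite fun j => hDo.preimage (hc j)),
    ⟨hxD, mem_iInter.2 fun j => by rwa [mem_preimage, hx j]⟩, fun u hu => (hD u hu.1).1,
    fun i => Subset.antisymm (hmaps i).image_subset fun u hu => ?_⟩
  exact ⟨Θ (r i) u, hmaps _ hu, (hD u hu.1).2.2 i⟩

lemma IsLocalDiffeomorph.isLocallyInjective {E E' X X' P Q : Type*}
    [NormedAddCommGroup E] [NormedSpace ℝ E] [NormedAddCommGroup E'] [NormedSpace ℝ E']
    [TopologicalSpace X] [TopologicalSpace X'] {I : ModelWithCorners ℝ E X}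
    {J : ModelWithCorners ℝ E' X'} [TopologicalSpace P] [ChartedSpace X P]
    [TopologicalSpace Q] [ChartedSpace X' Q] {r : WithTop ℕ∞} {f : P → Q}
    (hf : IsLocalDiffeomorph I J r f) : IsLocallyInjective f :=
  hf.isLocalHomeomorph.isLocallyInjective

/-- Two lifts through a locally injective map agree on an open set. Applied to source or target,
this extends an identity between arrows at one point to nearby points. -/
lemma IsLocallyInjective.eventually_eq_of_comp_eq {A X Y : Type*} [TopologicalSpace A]
    [TopologicalSpace X] {f : X → Y} (hf : IsLocallyInjective f) {g₁ g₂ : A → X}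
    (h₁ : Continuous g₁) (h₂ : Continuous g₂) (he : ∀ a, f (g₁ a) = f (g₂ a)) {a : A}
    (ha : g₁ a = g₂ a) : ∀ᶠ b in 𝓝 a, g₁ b = g₂ b :=
  (hf.isOpen_eqLocus h₁ h₂ (funext he)).mem_nhds ha

/-- If all points of the fibre product `P ×_Q P` close to `(x, x)` lie on the diagonal, `f` is
injective near `x`. -/
lemma exists_injOn_of_eventually_diagonal {P Q : Type*} [TopologicalSpace P] {f : P → Q} {x : P}
    (h : ∀ᶠ q in 𝓝 (⟨(x, x), rfl⟩ : {q : P × P // f q.1 = f q.2}), q.1.1 = q.1.2) :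
    ∃ U ∈ 𝓝 x, InjOn f U := by
  rw [nhds_subtype_eq_comap, Filter.eventually_comap, nhds_prod_eq,
    Filter.eventually_prod_self_iff'] at h
  obtain ⟨U, hU, hUh⟩ := h
  exact ⟨U, hU, fun a ha b hb hab => hUh a ha b hb ⟨(a, b), hab⟩ rfl⟩

/-! ### Locally injective submersions -/

section Submersion

variable {E E' P Q : Type*} [NormedAddCommGroup E] [NormedSpace ℝ E]
  [NormedAddCommGroup E'] [NormedSpace ℝ E'] [TopologicalSpace P] [ChartedSpace E P]
  [TopologicalSpace Q] [ChartedSpace E' Q]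

/-- A chart of the maximal atlas of a boundaryless manifold as a partial diffeomorphism. -/
noncomputable def PartialDiffeomorph.ofMemMaximalAtlas {r : WithTop ℕ∞}
    (e : OpenPartialHomeomorph P E) (he : e ∈ IsManifold.maximalAtlas 𝓘(ℝ, E) r P) :
    PartialDiffeomorph 𝓘(ℝ, E) 𝓘(ℝ, E) P E r where
  toPartialEquiv := e.toPartialEquiv
  open_source := e.open_source
  open_target := e.open_target
  contMDiffOn_toFun := contMDiffOn_of_mem_maximalAtlas he
  contMDiffOn_invFun := contMDiffOn_symm_of_mem_maximalAtlas he

/-- A submersion that is injective near `x` is a local diffeomorphism at `x`. -/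
lemma Manifold.IsSubmersionAt.isLocalDiffeomorphAt {f : P → Q} {x : P}
    (hf : Manifold.IsSubmersionAt 𝓘(ℝ, E) 𝓘(ℝ, E') ∞ f x) (hinj : ∃ U ∈ 𝓝 x, InjOn f U) :
    IsLocalDiffeomorphAt 𝓘(ℝ, E) 𝓘(ℝ, E') ∞ f x := by
  obtain ⟨U, hU, hinj⟩ := hinj
  set φ := hf.domChart
  set ψ := hf.codChart
  set e := hf.equiv
  have hw : ∀ v ∈ φ.target, ψ (f (φ.symm v)) = (e v).1 := by
    intro v hv
    have := hf.writtenInCharts (show v ∈ (hf.domChart.extend 𝓘(ℝ, E)).target by simpa using hv)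
    simpa using this
  have hxφ : x ∈ φ.source := hf.mem_domChart_source
  -- In the charts `f` is a linear projection, hence constant along the complement: a nonzero `w`
  -- would give points near `x` with the same value.
  have hsub : ∀ w : hf.complement, w = 0 := by
    intro w
    set γ : ℝ → E := fun c => φ x + c • e.symm (0, w) with hγ
    have hγc : Continuous γ := by fun_prop
    have hγ0 : γ 0 = φ x := by simp [hγ]
    have h1 : ∀ᶠ c in 𝓝 (0 : ℝ), γ c ∈ φ.target ∧ φ.symm (γ c) ∈ U := by
      have h2 : ∀ᶠ v in 𝓝 (γ 0), v ∈ φ.target ∧ φ.symm v ∈ U := by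
        rw [hγ0]
        refine (Filter.eventually_mem_set.2 (φ.open_target.mem_nhds (φ.map_source hxφ))).and ?_
        refine (φ.continuousAt_symm (φ.map_source hxφ)).preimage_mem_nhds ?_
        rwa [φ.left_inv hxφ]
      exact hγc.continuousAt.eventually h2
    obtain ⟨c, ⟨hct, hcU⟩, hc0⟩ :=
      ((h1.filter_mono nhdsWithin_le_nhds).and (self_mem_nhdsWithin (s := {0}ᶜ))).exists
    have hfc : f (φ.symm (γ c)) = f x := by
      have hxs := hf.source_subset_preimage_source hxφ
      have hcs := hf.source_subset_preimage_source (φ.map_target hct)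
      apply ψ.injOn hcs hxs
      have h3 := hw _ (φ.map_source hxφ)
      rw [φ.left_inv hxφ] at h3
      rw [hw _ hct, h3, hγ]
      simp
    have h4 := hinj hcU (mem_of_mem_nhds hU) hfc
    have h5 : γ c = φ x := by rw [← φ.right_inv hct, h4]
    have h6 : c • e.symm (0, w) = 0 := by simpa [hγ] using h5
    have h7 : e.symm (0, w) = 0 := (smul_eq_zero.1 h6).resolve_left hc0
    simpa using e.symm.map_eq_zero_iff.1 h7
  have : Unique hf.complement := ⟨⟨0⟩, hsub⟩
  -- With trivial complement the projection is a linear isomorphism, and `f` is `ψ⁻¹ ∘ L ∘ φ` near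
  -- `x`.
  let L : E ≃L[ℝ] E' := e.trans (ContinuousLinearEquiv.prodUnique ℝ E' hf.complement)
  have hL : ∀ v, L v = (e v).1 := fun v => rfl
  let Φ := ((PartialDiffeomorph.ofMemMaximalAtlas φ hf.domChart_mem_maximalAtlas).trans
    (L.toDiffeomorph.toPartialDiffeomorph)).trans
      (PartialDiffeomorph.ofMemMaximalAtlas ψ hf.codChart_mem_maximalAtlas).symm
  have hxs : ∀ u ∈ φ.source, L (φ u) = ψ (f u) := fun u hu => by
    rw [hL, ← hw _ (φ.map_source hu), φ.left_inv hu]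
  have hψs : ∀ u ∈ φ.source, f u ∈ ψ.source := fun u hu => hf.source_subset_preimage_source hu
  refine ⟨Φ, ⟨⟨hxφ, trivial⟩, ?_⟩, ?_⟩
  · change L (φ x) ∈ ψ.target
    rw [hxs x hxφ]
    exact ψ.map_source (hψs x hxφ)
  · rintro u ⟨⟨hu, -⟩, -⟩
    change f u = ψ.symm (L (φ u))
    rw [hxs u hu, ψ.left_inv (hψs u hu)]

end Submersion

/-- One neighbourhood serves all its open subsets, so the bisection can be chosen later. -/
lemma IsLocalDiffeomorphAt.exists_isDiffeoOn {E E' X X' P Q : Type*}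
    [NormedAddCommGroup E] [NormedSpace ℝ E] [NormedAddCommGroup E'] [NormedSpace ℝ E']
    [TopologicalSpace X] [TopologicalSpace X'] {I : ModelWithCorners ℝ E X}
    {J : ModelWithCorners ℝ E' X'} [TopologicalSpace P] [ChartedSpace X P]
    [TopologicalSpace Q] [ChartedSpace X' Q] {f : P → Q} {x : P}
    (hf : IsLocalDiffeomorphAt I J ∞ f x) :
    ∃ U ∈ 𝓝 x, InjOn f U ∧
      ∀ S ⊆ U, IsOpen S → IsOpen (f '' S) ∧ IsDiffeoOn I J f S (f '' S) := by
  obtain ⟨Φ, hx, hΦ⟩ := hf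
  refine ⟨Φ.source, Φ.open_source.mem_nhds hx, Φ.injOn.congr hΦ.symm, fun S hS hSo => ?_⟩
  have him : f '' S = Φ '' S := (hΦ.mono hS).image_eq
  refine ⟨him ▸ Φ.toOpenPartialHomeomorph.isOpen_image_of_subset_source hSo hS,
    (Φ.contMDiffOn.congr hΦ).mono hS, rfl, Φ.invFun, Φ.contMDiffOn_invFun.mono ?_, fun u hu => ?_⟩
  · rw [him]
    rintro _ ⟨u, hu, rfl⟩
    exact Φ.map_source (hS hu)
  · rw [hΦ (hS hu)]
    exact Φ.left_inv (hS hu)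

/-! ### Bisections of translation open sets -/

namespace ProperEtaleGroupoid

variable {n : ℕ} {G₀ G₁ : Type*}
  [TopologicalSpace G₀] [ChartedSpace (EuclideanSpace ℝ (Fin n)) G₀]
  [TopologicalSpace G₁] [ChartedSpace (EuclideanSpace ℝ (Fin n)) G₁]
  {G : ProperEtaleGroupoid n G₀ G₁}

namespace SelfBisection

variable {V : Opens G₀}

/-- The map `u ↦ t(σ(u))` by which a local bisection `σ` of `V` onto itself acts on `V`. -/
def act (σ : G.SelfBisection V) (u : V) : V :=
  ⟨G.t (σ.1 u), σ.2.2.subset (mem_range_self u)⟩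

lemma continuous_coe (σ : G.SelfBisection V) : Continuous σ.1 :=
  σ.2.1.smooth.continuous

lemma continuous_act (σ : G.SelfBisection V) : Continuous σ.act :=
  (G.etale_t.contMDiff.continuous.comp σ.continuous_coe).subtype_mk _

lemma s_coe (σ : G.SelfBisection V) (u : V) : G.s (σ.1 u) = u :=
  σ.2.1.section_s u

/-- The pointwise product of two local bisections is continuous. -/
lemma continuous_comp (σ ρ : G.SelfBisection V) :
    Continuous fun u : V => G.comp (σ.1 (ρ.act u)) (ρ.1 u) :=
  G.smooth_comp.continuousOn.comp_continuous
    (f := fun u : V => (σ.1 (ρ.act u), ρ.1 u))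
    ((σ.continuous_coe.comp ρ.continuous_act).prodMk ρ.continuous_coe)
    fun u => σ.s_coe (ρ.act u)

lemma s_comp (σ ρ : G.SelfBisection V) (u : V) :
    G.s (G.comp (σ.1 (ρ.act u)) (ρ.1 u)) = u :=
  (G.s_comp _ _ (σ.s_coe _)).trans (ρ.s_coe u)

lemma t_comp (σ ρ : G.SelfBisection V) (u : V) :
    G.t (G.comp (σ.1 (ρ.act u)) (ρ.1 u)) = σ.act (ρ.act u) :=
  G.t_comp _ _ (σ.s_coe _)

lemma bisectionImage_eq (σ : G.SelfBisection V) (A : Set V) :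
    G.bisectionImage σ ((↑) '' A) = (↑) '' (σ.act '' A) := by
  ext y
  constructor
  · rintro ⟨u, ⟨v, hv, hvu⟩, rfl⟩
    obtain rfl := Subtype.ext hvu
    exact ⟨_, ⟨v, hv, rfl⟩, rfl⟩
  · rintro ⟨_, ⟨v, hv, rfl⟩, rfl⟩
    exact ⟨v, ⟨v, hv, rfl⟩, rfl⟩

end SelfBisection

namespace IsTranslationOpen

variable {V : Opens G₀} (hV : G.IsTranslationOpen V)
include hV

/-- This is surjectivity of evaluation; the source determines the point of evaluation. -/
lemma exists_selfBisection_eq {x : V} {g : G₁} (hs : G.s g = x) (ht : G.t g ∈ V) :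
    ∃ σ : G.SelfBisection V, σ.1 x = g := by
  obtain ⟨⟨σ, u⟩, h⟩ := hV.eval_bijective.2 ⟨g, by rw [hs]; exact x.2, ht⟩
  have h' : σ.1 u = g := congrArg Subtype.val h
  have hux : u = x := Subtype.ext (by rw [← σ.s_coe u, h', hs])
  exact ⟨σ, hux ▸ h'⟩

/-- Near a point `x` that they fix, the product of two bisections of `V` is a bisection of `V`. -/
lemma exists_act_act_eventually_eq {x : V} {σ ρ : G.SelfBisection V} (hσ : σ.act x = x)
    (hρ : ρ.act x = x) :
    ∃ κ : G.SelfBisection V, κ.act x = x ∧ ∀ᶠ u in 𝓝 x, σ.act (ρ.act u) = κ.act u := by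
  have htx : G.t (G.comp (σ.1 (ρ.act x)) (ρ.1 x)) = x := by
    rw [SelfBisection.t_comp, hρ, hσ]
  obtain ⟨κ, hκ⟩ := hV.exists_selfBisection_eq (SelfBisection.s_comp σ ρ x) (by
    rw [htx]; exact x.2)
  refine ⟨κ, Subtype.ext ((congrArg G.t hκ).trans htx), ?_⟩
  filter_upwards [G.etale_s.isLocallyInjective.eventually_eq_of_comp_eq
    (SelfBisection.continuous_comp σ ρ) κ.continuous_coe
    (fun u => by rw [SelfBisection.s_comp, κ.s_coe]) hκ.symm] with u hu
  exact Subtype.ext (by rw [← SelfBisection.t_comp, hu]; rfl)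

/-- Near a point `x` that it fixes, a bisection of `V` is inverted by another one. -/
lemma exists_act_act_eventually_eq_self {x : V} {σ : G.SelfBisection V} (hσ : σ.act x = x) :
    ∃ ρ : G.SelfBisection V, ρ.act x = x ∧ ∀ᶠ u in 𝓝 x, σ.act (ρ.act u) = u := by
  have hσ' : G.t (σ.1 x) = x := congrArg Subtype.val hσ
  obtain ⟨ρ, hρ⟩ := hV.exists_selfBisection_eq (x := x) (g := G.inv (σ.1 x))
    (by rw [G.s_inv, hσ']) (by rw [G.t_inv, σ.s_coe]; exact x.2)
  have hρx : ρ.act x = x := Subtype.ext (by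
    change G.t (ρ.1 x) = x
    rw [hρ, G.t_inv, σ.s_coe])
  refine ⟨ρ, hρx, ?_⟩
  filter_upwards [G.etale_s.isLocallyInjective.eventually_eq_of_comp_eq
    (g₂ := fun u : V => G.unit u) (a := x)
    (SelfBisection.continuous_comp σ ρ) (G.smooth_unit.continuous.comp continuous_subtype_val)
    (fun u => by rw [SelfBisection.s_comp, G.s_unit])
    (by rw [hρx, hρ, G.comp_inv, hσ'])] with u hu
  exact Subtype.ext (by rw [← SelfBisection.t_comp, hu, G.t_unit])

/-- Every point `x` of a translation open set `V` has arbitrarily small open neighbourhoods that are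
invariant, with stabiliser that of `x`. -/
lemma exists_isOpen_invariant [T2Space G₀] (x : V) {N : Set G₀} (hN : N ∈ 𝓝 (x : G₀)) :
    ∃ A : Set G₀, IsOpen A ∧ (x : G₀) ∈ A ∧ A ⊆ N ∧ A ⊆ V ∧ ∀ σ : G.SelfBisection V,
      (σ.act x = x → G.bisectionImage σ A = A) ∧
      (σ.act x ≠ x → G.bisectionImage σ A ∩ A = ∅) := by
  have := hV.finite
  -- Each bisection moving `x` is separated from it by the Hausdorff property; finiteness allows
  -- intersecting the resulting neighbourhoods.
  have hoff : ∀ σ : G.SelfBisection V, ∃ D ∈ 𝓝 x, σ.act x ≠ x → σ.act '' D ∩ D = ∅ := by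
    intro σ
    by_cases hσ : σ.act x = x
    · exact ⟨univ, Filter.univ_mem, fun h => absurd hσ h⟩
    obtain ⟨P, Q, hP, hQ, hxP, hxQ, hPQ⟩ := t2_separation hσ
    refine ⟨σ.act ⁻¹' P ∩ Q, Filter.inter_mem
      (σ.continuous_act.continuousAt.preimage_mem_nhds (hP.mem_nhds hxP)) (hQ.mem_nhds hxQ),
      fun _ => ?_⟩
    rw [← disjoint_iff_inter_eq_empty]
    exact hPQ.mono (image_subset_iff.2 inter_subset_left) inter_subset_right
  choose D hD hDoff using hoff
  obtain ⟨A, hAo, hxA, hAN, hA⟩ := exists_isOpen_image_eq_of_finite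
    (fun σ : {σ : G.SelfBisection V // σ.act x = x} => σ.1.act) (fun σ => σ.1.continuous_act)
    (x := x) (fun σ => σ.2)
    (fun σ ρ => by
      obtain ⟨κ, hκ, h⟩ := hV.exists_act_act_eventually_eq σ.2 ρ.2
      exact ⟨⟨κ, hκ⟩, h⟩)
    (fun σ => by
      obtain ⟨ρ, hρ, h⟩ := hV.exists_act_act_eventually_eq_self σ.2
      exact ⟨⟨ρ, hρ⟩, h⟩)
    (Filter.inter_mem (continuous_subtype_val.continuousAt.preimage_mem_nhds hN)
      (Filter.iInter_mem.2 hD))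
  refine ⟨(↑) '' A, V.isOpen.isOpenMap_subtype_val _ hAo, mem_image_of_mem _ hxA,
    image_subset_iff.2 fun u hu => (hAN hu).1, Subtype.coe_image_subset _ _, fun σ => ⟨?_, ?_⟩⟩
  · intro hσ
    rw [σ.bisectionImage_eq, hA ⟨σ, hσ⟩]
  · intro hσ
    rw [σ.bisectionImage_eq, ← image_inter Subtype.val_injective, image_eq_empty,
      ← subset_empty_iff, ← hDoff σ hσ]
    have hAD : A ⊆ D σ := fun u hu => mem_iInter.1 (hAN hu).2 σ
    exact inter_subset_inter (image_mono hAD) hAD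

end IsTranslationOpen

end ProperEtaleGroupoid

/-! ### The bundle maps are local diffeomorphisms -/

namespace MoritaBibundle

variable {n p k : ℕ} {G₀ G₁ H₀ H₁ : Type*}
  [TopologicalSpace G₀] [ChartedSpace (EuclideanSpace ℝ (Fin n)) G₀]
  [TopologicalSpace G₁] [ChartedSpace (EuclideanSpace ℝ (Fin n)) G₁]
  [TopologicalSpace H₀] [ChartedSpace (EuclideanSpace ℝ (Fin p)) H₀]
  [TopologicalSpace H₁] [ChartedSpace (EuclideanSpace ℝ (Fin p)) H₁]
  {G : ProperEtaleGroupoid n G₀ G₁} {H : ProperEtaleGroupoid p H₀ H₁}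
  {M : Type*} [TopologicalSpace M] [ChartedSpace (EuclideanSpace ℝ (Fin k)) M]
  (B : MoritaBibundle k G H M)

lemma continuous_τ : Continuous B.τ := B.τ_submersion.contMDiff.continuous

lemma continuous_ε : Continuous B.ε := B.ε_submersion.contMDiff.continuous

/-- As `H` is étale and `M` is a principal left `H`-bundle over `G₀`, the map `τ` is locally
injective. -/
lemma exists_injOn_τ (m : M) : ∃ U ∈ 𝓝 m, InjOn B.τ U := by
  obtain ⟨-, him, r, hr, hinv⟩ := B.left_principal
  -- The first component of `r` is the division map: the arrow taking `q.2` to `q.1`.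
  have hdiv : ∀ q ∈ {q : M × M | B.τ q.1 = B.τ q.2},
      H.s (r q).1 = B.ε q.2 ∧ B.lAct (r q).1 q.2 = q.1 := by
    intro q hq
    obtain ⟨⟨h, b⟩, hA, rfl⟩ := him.symm.subset hq
    rw [hinv hA]
    exact ⟨hA, rfl⟩
  have hdiag : (r (m, m)).1 = H.unit (B.ε m) := by
    have := hinv (show (H.unit (B.ε m), m) ∈ {q : H₁ × M | H.s q.1 = B.ε q.2} from H.s_unit _)
    simp only [B.unit_lAct] at this
    rw [this]
  refine exists_injOn_of_eventually_diagonal ?_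
  filter_upwards [H.etale_s.isLocallyInjective.eventually_eq_of_comp_eq
    (g₁ := fun q : {q : M × M // B.τ q.1 = B.τ q.2} => (r q.1).1)
    (g₂ := fun q => H.unit (B.ε q.1.2))
    (continuous_fst.comp (hr.continuousOn.comp_continuous continuous_subtype_val fun q => q.2))
    (H.smooth_unit.continuous.comp
      (B.continuous_ε.comp (continuous_snd.comp continuous_subtype_val)))
    (fun q => by rw [(hdiv q.1 q.2).1, H.s_unit]) hdiag] with q hq
  rw [← (hdiv q.1 q.2).2, hq, B.unit_lAct]

/-- As `G` is étale and `M` is a principal right `G`-bundle over `H₀`, the map `ε` is locally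
injective. -/
lemma exists_injOn_ε (m : M) : ∃ U ∈ 𝓝 m, InjOn B.ε U := by
  obtain ⟨-, him, r, hr, hinv⟩ := B.right_principal
  have hdiv : ∀ q ∈ {q : M × M | B.ε q.1 = B.ε q.2},
      G.t (r q).2 = B.τ q.1 ∧ B.rAct q.1 (r q).2 = q.2 := by
    intro q hq
    obtain ⟨⟨b, g⟩, hA, rfl⟩ := him.symm.subset hq
    rw [hinv hA]
    exact ⟨Eq.symm hA, rfl⟩
  have hdiag : (r (m, m)).2 = G.unit (B.τ m) := by
    have := hinv (show (m, G.unit (B.τ m)) ∈ {q : M × G₁ | B.τ q.1 = G.t q.2} from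
      (G.t_unit _).symm)
    simp only [B.rAct_unit] at this
    rw [this]
  refine exists_injOn_of_eventually_diagonal ?_
  filter_upwards [G.etale_t.isLocallyInjective.eventually_eq_of_comp_eq
    (g₁ := fun q : {q : M × M // B.ε q.1 = B.ε q.2} => (r q.1).2)
    (g₂ := fun q => G.unit (B.τ q.1.1))
    (continuous_snd.comp (hr.continuousOn.comp_continuous continuous_subtype_val fun q => q.2))
    (G.smooth_unit.continuous.comp
      (B.continuous_τ.comp (continuous_fst.comp continuous_subtype_val)))
    (fun q => by rw [(hdiv q.1 q.2).1, G.t_unit]) hdiag] with q hq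
  rw [← (hdiv q.1 q.2).2, hq, B.rAct_unit]

/-- The map `τ` is a local diffeomorphism. -/
lemma isLocalDiffeomorph_τ : IsLocalDiffeomorph (𝓡 k) (𝓡 n) ∞ B.τ := fun m =>
  (B.τ_submersion.isSubmersionAt m).isLocalDiffeomorphAt (B.exists_injOn_τ m)

/-- The map `ε` is a local diffeomorphism. -/
lemma isLocalDiffeomorph_ε : IsLocalDiffeomorph (𝓡 k) (𝓡 p) ∞ B.ε := fun m =>
  (B.ε_submersion.isSubmersionAt m).isLocalDiffeomorphAt (B.exists_injOn_ε m)

/-! ### Transport by pairs of bisections -/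

section Transport

variable {V : Opens G₀} {W : Opens H₀} (h : H.SelfBisection W) (σ : G.SelfBisection V)

/-- The action `m ↦ h m σ⁻¹` of a pair of local bisections on the part of `M` over `V` and `W`. -/
def transport (q : {m : M // B.τ m ∈ V ∧ B.ε m ∈ W}) : M :=
  B.rAct (B.lAct (h.1 ⟨B.ε q, q.2.2⟩) q) (G.inv (σ.1 ⟨B.τ q, q.2.1⟩))

lemma τ_lAct_selfBisection (q : {m : M // B.τ m ∈ V ∧ B.ε m ∈ W}) :
    B.τ (B.lAct (h.1 ⟨B.ε q, q.2.2⟩) q) = G.t (G.inv (σ.1 ⟨B.τ q, q.2.1⟩)) := by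
  rw [B.τ_lAct _ _ (h.s_coe _), G.t_inv, σ.s_coe]

lemma τ_transport (q : {m : M // B.τ m ∈ V ∧ B.ε m ∈ W}) :
    B.τ (B.transport h σ q) = σ.act ⟨B.τ q, q.2.1⟩ := by
  rw [transport, B.τ_rAct _ _ (B.τ_lAct_selfBisection h σ q), G.s_inv]
  rfl

lemma ε_transport (q : {m : M // B.τ m ∈ V ∧ B.ε m ∈ W}) :
    B.ε (B.transport h σ q) = h.act ⟨B.ε q, q.2.2⟩ := by
  rw [transport, B.ε_rAct _ _ (B.τ_lAct_selfBisection h σ q), B.ε_lAct _ _ (h.s_coe _)]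
  rfl

lemma continuous_transport : Continuous (B.transport h σ) := by
  have hh : Continuous fun q : {m : M // B.τ m ∈ V ∧ B.ε m ∈ W} => h.1 ⟨B.ε q, q.2.2⟩ :=
    h.continuous_coe.comp ((B.continuous_ε.comp continuous_subtype_val).subtype_mk _)
  have hσ : Continuous fun q : {m : M // B.τ m ∈ V ∧ B.ε m ∈ W} => G.inv (σ.1 ⟨B.τ q, q.2.1⟩) :=
    G.smooth_inv.continuous.comp
      (σ.continuous_coe.comp ((B.continuous_τ.comp continuous_subtype_val).subtype_mk _))
  have hl := B.smooth_lAct.continuousOn.comp_continuous (hh.prodMk continuous_subtype_val)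
    fun q => h.s_coe _
  exact B.smooth_rAct.continuousOn.comp_continuous (hl.prodMk hσ)
    fun q => B.τ_lAct_selfBisection h σ q

variable {h}

/-- A local bisection `h` of `H` fixing `ε m` is matched by a local bisection `σ` of `G` fixing
`τ m` such that `h m σ⁻¹ = m`. -/
lemma exists_transport_eq_self (hV : G.IsTranslationOpen V)
    (q : {m : M // B.τ m ∈ V ∧ B.ε m ∈ W}) (hq : h.act ⟨B.ε q, q.2.2⟩ = ⟨B.ε q, q.2.2⟩) :
    ∃ σ : G.SelfBisection V, σ.act ⟨B.τ q, q.2.1⟩ = ⟨B.τ q, q.2.1⟩ ∧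
      B.transport h σ q = q := by
  have hε : B.ε (B.lAct (h.1 ⟨B.ε q, q.2.2⟩) q) = B.ε q :=
    (B.ε_lAct _ _ (h.s_coe _)).trans (congrArg Subtype.val hq)
  -- `q` and `h q` lie in one `ε`-fibre, so `h q = q g`; the bisection through `g` then undoes `h`
  -- at `q`.
  obtain ⟨⟨b, g⟩, hbg, hb⟩ := B.right_principal.2.1.symm.subset
    (show ((q : M), B.lAct (h.1 ⟨B.ε q, q.2.2⟩) q) ∈ {z : M × M | B.ε z.1 = B.ε z.2} from hε.symm)
  obtain ⟨rfl, hact⟩ := Prod.mk.inj hb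
  have ht : B.τ q = G.t g := hbg
  have hs : G.s g = B.τ q := by
    rw [← B.τ_rAct _ _ ht, hact, B.τ_lAct _ _ (h.s_coe _)]
  obtain ⟨σ, hσ⟩ := hV.exists_selfBisection_eq (x := ⟨B.τ q, q.2.1⟩) hs (ht ▸ q.2.1)
  refine ⟨σ, Subtype.ext ((congrArg G.t hσ).trans ht.symm), ?_⟩
  rw [transport, hσ, ← hact, B.rAct_comp _ _ _ ht (G.t_inv g).symm, G.comp_inv, ← ht,
    B.rAct_unit]

end Transport

end MoritaBibundle

namespace ProperEtaleGroupoid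

variable {n : ℕ} {G₀ G₁ : Type*}
  [TopologicalSpace G₀] [ChartedSpace (EuclideanSpace ℝ (Fin n)) G₀]
  [TopologicalSpace G₁] [ChartedSpace (EuclideanSpace ℝ (Fin n)) G₁]
  {G : ProperEtaleGroupoid n G₀ G₁}

lemma SelfBisection.bisectionImage_mono {V : Opens G₀} (σ : G.SelfBisection V) {A A' : Set G₀}
    (h : A ⊆ A') : G.bisectionImage σ A ⊆ G.bisectionImage σ A' := by
  rintro y ⟨u, hu, hy⟩
  exact ⟨u, h hu, hy⟩

end ProperEtaleGroupoid

/-! ### Construction of invariant local bisections -/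

namespace MoritaBibundle

variable {n p k : ℕ} {G₀ G₁ H₀ H₁ : Type*}
  [TopologicalSpace G₀] [ChartedSpace (EuclideanSpace ℝ (Fin n)) G₀]
  [TopologicalSpace G₁] [ChartedSpace (EuclideanSpace ℝ (Fin n)) G₁]
  [TopologicalSpace H₀] [ChartedSpace (EuclideanSpace ℝ (Fin p)) H₀]
  [TopologicalSpace H₁] [ChartedSpace (EuclideanSpace ℝ (Fin p)) H₁]
  {G : ProperEtaleGroupoid n G₀ G₁} {H : ProperEtaleGroupoid p H₀ H₁}
  {M : Type*} [TopologicalSpace M] [ChartedSpace (EuclideanSpace ℝ (Fin k)) M]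
  (B : MoritaBibundle k G H M)

lemma isOpen_chartRegion (𝒱 : Set (Opens G₀)) (𝒲 : Set (Opens H₀)) :
    IsOpen (B.chartRegion 𝒱 𝒲) :=
  ((isOpen_biUnion fun V _ => V.isOpen).preimage B.continuous_τ).inter
    ((isOpen_biUnion fun W _ => W.isOpen).preimage B.continuous_ε)

lemma IsInvariantLocalBisection.subset_chartRegion {B : MoritaBibundle k G H M}
    {𝒱 : Set (Opens G₀)} {𝒲 : Set (Opens H₀)} {S : Set M}
    (hS : B.IsInvariantLocalBisection 𝒱 𝒲 S) : S ⊆ B.chartRegion 𝒱 𝒲 := by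
  obtain ⟨V, hV, hSV, -⟩ := hS.invariant_τ
  obtain ⟨W, hW, hSW, -⟩ := hS.invariant_ε
  exact fun m hm => ⟨mem_biUnion hV (hSV (mem_image_of_mem _ hm)),
    mem_biUnion hW (hSW (mem_image_of_mem _ hm))⟩

/-- Every point over translation open sets `V` and `W` has arbitrarily small neighbourhoods that are
invariant local bisections. -/
lemma exists_isInvariantLocalBisection [T2Space G₀] [T2Space H₀] {𝒱 : Set (Opens G₀)}
    {𝒲 : Set (Opens H₀)} {V : Opens G₀} {W : Opens H₀} (hV𝒱 : V ∈ 𝒱) (hW𝒲 : W ∈ 𝒲)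
    (hV : G.IsTranslationOpen V) (hW : H.IsTranslationOpen W) {m : M}
    (hm : B.τ m ∈ V ∧ B.ε m ∈ W) {N : Set M} (hN : N ∈ 𝓝 m) :
    ∃ S, B.IsInvariantLocalBisection 𝒱 𝒲 S ∧ m ∈ S ∧ S ⊆ N := by
  have := hW.finite
  obtain ⟨Uτ, hUτ, hinj, hdτ⟩ := (B.isLocalDiffeomorph_τ m).exists_isDiffeoOn
  obtain ⟨Uε, hUε, -, hdε⟩ := (B.isLocalDiffeomorph_ε m).exists_isDiffeoOn
  obtain ⟨O, hON, hO, hmO⟩ := mem_nhds_iff.1 (Filter.inter_mem hN (Filter.inter_mem hUτ hUε))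
  replace hinj : InjOn B.τ O := hinj.mono fun q hq => (hON hq).2.1
  -- Keeping `ε(S)` inside `C` settles every `h` that moves `ε m`.
  obtain ⟨C, hC, hmC, -, hCW, hCh⟩ := hW.exists_isOpen_invariant ⟨B.ε m, hm.2⟩ Filter.univ_mem
  set R : Set M := {m | B.τ m ∈ V ∧ B.ε m ∈ W}
  have hRo : IsOpen R := (V.isOpen.preimage B.continuous_τ).inter
    (W.isOpen.preimage B.continuous_ε)
  -- every `h` fixing `ε m` is matched by some `σ` fixing `τ m`, such that `O` is stable near `m`
  have hmatch : ∀ h : H.SelfBisection W, ∃ σ : G.SelfBisection V, ∃ D ∈ 𝓝 m,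
      h.act ⟨B.ε m, hm.2⟩ = ⟨B.ε m, hm.2⟩ → σ.act ⟨B.τ m, hm.1⟩ = ⟨B.τ m, hm.1⟩ ∧
        ∀ q : R, (q : M) ∈ D → B.transport h σ q ∈ O := by
    intro h
    by_cases hh : h.act ⟨B.ε m, hm.2⟩ = ⟨B.ε m, hm.2⟩
    · obtain ⟨σ, hσ, hσm⟩ := B.exists_transport_eq_self hV ⟨m, hm⟩ hh
      have hpre : B.transport h σ ⁻¹' O ∈ 𝓝 (⟨m, hm⟩ : R) :=
        (B.continuous_transport h σ).continuousAt.preimage_mem_nhds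
          (hσm ▸ hO.mem_nhds hmO)
      obtain ⟨D, hD, hDO⟩ := mem_nhds_subtype _ _ _ |>.1 hpre
      exact ⟨σ, D, hD, fun _ => ⟨hσ, fun q hq => hDO hq⟩⟩
    · obtain ⟨σ, -⟩ := hV.exists_selfBisection_eq (x := ⟨B.τ m, hm.1⟩) (G.s_unit (B.τ m))
        (by rw [G.t_unit]; exact hm.1)
      exact ⟨σ, univ, Filter.univ_mem, fun h' => absurd h' hh⟩
  choose σ D hD hσD using hmatch
  obtain ⟨O', hO'sub, hO', hmO'⟩ := mem_nhds_iff.1 (Filter.inter_mem (hO.mem_nhds hmO)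
    (Filter.inter_mem (hRo.mem_nhds hm) (Filter.inter_mem
      ((hC.preimage B.continuous_ε).mem_nhds hmC) (Filter.iInter_mem.2 hD))))
  obtain ⟨A, hA, hmA, hAO', hAV, hAσ⟩ := hV.exists_isOpen_invariant ⟨B.τ m, hm.1⟩
    ((hdτ O' (fun q hq => (hON (hO'sub hq).1).2.1) hO').1.mem_nhds (mem_image_of_mem _ hmO'))
  -- `S` is cut out of `O`, where the transports land, yet lies in `O'` because `A ⊆ τ(O')` and `τ`
  -- is injective on `O`.
  set S : Set M := O ∩ B.τ ⁻¹' A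
  have hSO : IsOpen S := hO.inter (hA.preimage B.continuous_τ)
  have hSO' : S ⊆ O' := by
    rintro q ⟨hqO, hqA⟩
    obtain ⟨q', hq', hqq'⟩ := hAO' hqA
    exact hinj (hO'sub hq').1 hqO hqq' ▸ hq'
  have hτS : B.τ '' S = A := by
    refine Subset.antisymm (image_subset_iff.2 inter_subset_right) fun x hx => ?_
    obtain ⟨q, hq, rfl⟩ := hAO' hx
    exact ⟨q, ⟨(hO'sub hq).1, hx⟩, rfl⟩
  have hεS : B.ε '' S ⊆ C := image_subset_iff.2 fun q hq => (hO'sub (hSO' hq)).2.2.1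
  have hmS : m ∈ S := ⟨hmO, hmA⟩
  obtain ⟨hτo, hτd⟩ := hdτ S (fun q hq => (hON hq.1).2.1) hSO
  obtain ⟨hεo, hεd⟩ := hdε S (fun q hq => (hON hq.1).2.2) hSO
  refine ⟨S, ⟨⟨m, hmS⟩, hSO, hτo, hεo, hτd, hεd, ⟨V, hV𝒱, ?_⟩, ⟨W, hW𝒲, hεS.trans hCW, ?_⟩⟩,
    hmS, fun q hq => (hON hq.1).1⟩
  · rw [hτS]
    exact ⟨hAV, fun ρ => (em _).imp (hAσ ρ).1 (hAσ ρ).2⟩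
  intro h
  by_cases hh : h.act ⟨B.ε m, hm.2⟩ = ⟨B.ε m, hm.2⟩
  swap
  · refine Or.inr (subset_empty_iff.1 ?_)
    rw [← (hCh h).2 hh]
    exact inter_subset_inter (h.bisectionImage_mono hεS) hεS
  left
  obtain ⟨hσm, hσO⟩ := hσD h hh
  have hAσ' := (hAσ (σ h)).1 hσm
  have hSR : ∀ q ∈ S, q ∈ R := fun q hq => (hO'sub (hSO' hq)).2.1
  have htO : ∀ q (hq : q ∈ S), B.transport h (σ h) ⟨q, hSR q hq⟩ ∈ O := fun q hq =>
    hσO ⟨q, hSR q hq⟩ (mem_iInter.1 (hO'sub (hSO' hq)).2.2.2 h)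
  ext y
  constructor
  · rintro ⟨u, ⟨q, hq, hqu⟩, rfl⟩
    obtain rfl : (⟨B.ε q, (hSR q hq).2⟩ : W) = u := Subtype.ext hqu
    refine ⟨B.transport h (σ h) ⟨q, hSR q hq⟩, ⟨htO q hq, ?_⟩, B.ε_transport h (σ h) _⟩
    rw [mem_preimage, B.τ_transport, ← hAσ']
    exact ⟨⟨B.τ q, (hSR q hq).1⟩, hq.2, rfl⟩
  -- Since `σ(A) = A`, some `q'` in `S` has its transport over `τ q`; both points lie in `O`, so the
  -- transport of `q'` is `q`.
  · rintro ⟨q, hq, rfl⟩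
    have hqA : B.τ q ∈ A := hq.2
    rw [← hAσ'] at hqA
    obtain ⟨u, huA, huq⟩ := hqA
    rw [← hτS] at huA
    obtain ⟨q', hq', hq'u⟩ := huA
    obtain rfl : (⟨B.τ q', (hSR q' hq').1⟩ : V) = u := Subtype.ext hq'u
    have hqq' : B.transport h (σ h) ⟨q', hSR q' hq'⟩ = q :=
      hinj (htO q' hq') hq.1 ((B.τ_transport h (σ h) _).trans huq)
    refine ⟨⟨B.ε q', (hSR q' hq').2⟩, mem_image_of_mem _ hq', ?_⟩
    rw [← hqq', B.ε_transport]
    rfl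

end MoritaBibundle

theorem mainTheorem9 {n p k : ℕ} {G₀ G₁ H₀ H₁ M : Type*}
    [TopologicalSpace G₀] [T2Space G₀]
    [ChartedSpace (EuclideanSpace ℝ (Fin n)) G₀] [IsManifold (𝓡 n) ∞ G₀]
    [TopologicalSpace G₁] [T2Space G₁]
    [ChartedSpace (EuclideanSpace ℝ (Fin n)) G₁] [IsManifold (𝓡 n) ∞ G₁]
    [TopologicalSpace H₀] [T2Space H₀]
    [ChartedSpace (EuclideanSpace ℝ (Fin p)) H₀] [IsManifold (𝓡 p) ∞ H₀]
    [TopologicalSpace H₁] [T2Space H₁]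
    [ChartedSpace (EuclideanSpace ℝ (Fin p)) H₁] [IsManifold (𝓡 p) ∞ H₁]
    [TopologicalSpace M] [T2Space M]
    [ChartedSpace (EuclideanSpace ℝ (Fin k)) M] [IsManifold (𝓡 k) ∞ M]
    (G : ProperEtaleGroupoid n G₀ G₁) (H : ProperEtaleGroupoid p H₀ H₁)
    (B : MoritaBibundle k G H M)
    (𝒱 : Set (Opens G₀)) (h𝒱 : ∀ V ∈ 𝒱, G.IsTranslationOpen V)
    (𝒲 : Set (Opens H₀)) (h𝒲 : ∀ W ∈ 𝒲, H.IsTranslationOpen W) :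
    (∀ S, B.IsInvariantLocalBisection 𝒱 𝒲 S → S ⊆ B.chartRegion 𝒱 𝒲) ∧
    IsTopologicalBasis
      {T : Set (B.chartRegion 𝒱 𝒲) |
        B.IsInvariantLocalBisection 𝒱 𝒲 (Subtype.val '' T)} := by
  refine ⟨fun S hS => hS.subset_chartRegion, isTopologicalBasis_of_isOpen_of_nhds ?_ ?_⟩
  · intro T hT
    rw [← preimage_image_eq T Subtype.val_injective]
    exact hT.isOpen.preimage continuous_subtype_val
  · rintro ⟨m, hm⟩ U hmU hU
    obtain ⟨V, hV, hmV⟩ := mem_iUnion₂.1 hm.1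
    obtain ⟨W, hW, hmW⟩ := mem_iUnion₂.1 hm.2
    obtain ⟨S, hS, hmS, hSU⟩ := B.exists_isInvariantLocalBisection hV hW (h𝒱 V hV) (h𝒲 W hW)
      ⟨hmV, hmW⟩ (((B.isOpen_chartRegion 𝒱 𝒲).isOpenMap_subtype_val U hU).mem_nhds ⟨_, hmU, rfl⟩)
    have hval : (Subtype.val '' (Subtype.val ⁻¹' S : Set (B.chartRegion 𝒱 𝒲))) = S := by
      rw [image_preimage_eq_inter_range, Subtype.range_coe, inter_eq_left]
      exact hS.subset_chartRegion
    have hS' : B.IsInvariantLocalBisection 𝒱 𝒲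
        (Subtype.val '' (Subtype.val ⁻¹' S : Set (B.chartRegion 𝒱 𝒲))) := hval.symm ▸ hS
    refine ⟨Subtype.val ⁻¹' S, hS', hmS, fun q hq => ?_⟩
    obtain ⟨q', hq', hqq'⟩ := hSU hq
    exact Subtype.ext hqq' ▸ hq'
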